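/- **Setting.** Let $(I,\preceq)$ be a finite partially ordered set and let $\mathcal A=\prod_{i,j\in I}\mathcal A_{ij}$ be a Vinberg algebra over $I$. That is, the $\mathcal A_{ij}$ are finite-dimensional real vector spaces with $\mathcal A_{ii}=\mathbb R$, $\mathcal A_{ij}=\mathcal A_{ji}=E_{ij}\neq\{0\}$ for $j\prec i$, and $\mathcal A_{ij}=\{0\}$ if $i,j$ are incomparable; the elements $A=(a_{ij})$ are regarded as matrices, $\operatorname{tr}A=\sum_i a_{ii}$; there are bilinear maps $\mathcal A_{ij}\times\mathcal A_{jk}\to\mathcal A_{ik}$ defining the product $(AB)_{ij}=\sum_\mu a_{i\mu}b_{\mu j}$, for which $e=\operatorname{diag}(1)$ is a two-sided unit, and a linear involution $A\mapsto A^*$ exchanging $\mathcal A_{ij}$ and $\mathcal A_{ji}$ and fixing diagonal entries. With $\mathcal T_l=\{A:\ a_{ij}=0 \text{ unless } j\preceq i\}$ the following hold: $\operatorname{tr}(AA^*)>0$ for $A\ne0$; $(AB)^*=B^*A^*$; $\operatorname{tr}(AB)=\operatorname{tr}(BA)$; $\operatorname{tr}(A(BC))=\operatorname{tr}((AB)C)$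 for $A,B,C\in\mathcal A$; and $(ST)U=S(TU)$, $T(UU^*)=(TU)U^*$ for $S,T,U\in\mathcal T_l$. For $j\prec i$ the space $E_{ij}$ carries the Euclidean norm $\|a\|^2=aa^*$ and the corresponding Lebesgue measure, and $n_{ij}=\dim E_{ij}$. Let $\mathcal T_l^+$ be the set of $T\in\mathcal T_l$ with $t_{ii}>0$ for all $i$. An element $X=TT^*$ with $T\in\mathcal T_l^+$ determines $T$; put $\Delta_{\preceq k}(X)=\prod_{j\preceq k}t_{jj}^2$, $\Delta_{\prec k}(X)=\prod_{j\prec k}t_{jj}^2$ and, for $i\in I$ and $\chi=(\lambda_j)_{j\in I}\in\mathbb R^I$, $$\Delta^{(i)}_\chi(X)=\prod_{k\succeq i}\Big(\frac{\Delta_{\preceq k}(X)}{\Delta_{\prec k}(X)}\Big)^{\lambda_k}.$$ Let $i\in I$, let $\psi:I\to\{0,1\}$ be a map with $\psi(j)=0$ unless $i\preceq j$, and put $e_\psi=\operatorname{diag}(\psi)$, $T\cdot e_\psi=Te_\psi T^*$, $\mathcal T_l^+\cdot e_\psi=\{T\cdot e_\psi:\ T\in\mathcal T_l^+\}$, $$n^i_j=\sum_{k\prec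 j}\psi(k)\,n_{jk},\qquad |\psi|=\sum_{j\succeq i}\psi(j),\qquad |n^\psi|=\sum_{j\succeq i}n^i_j .$$ Let $\chi_i=(\lambda_j)_{j\in I}\in\mathbb R^I$ with $\lambda_j=0$ whenever $i\not\preceq j$ or $\psi(j)=0$, and define $\Delta^\psi_{\chi_i}(T\cdot e_\psi)=\Delta^{(i)}_{\chi_i}(TT^*)$ for $T\in\mathcal T_l^+$. Let $\nu_\psi$ be the measure on $\mathcal T_l^+\cdot e_\psi$ given, for $\psi\neq0$, by $$\nu_\psi(d(T\cdot e_\psi))=\Delta^{(i)}_{\dot\chi}(TT^*)\prod_{i\preceq j\preceq k,\ \psi(j)=1}dt_{kj},$$ where $\dot\chi=(\dot\lambda_j)$ with $\dot\lambda_j=-\psi(j)(1+n^i_j)/2$ if $i\preceq j$ and $\dot\lambda_j=0$ otherwise, and let $\nu_0$ be the Dirac measure at $0$. **Theorem 3.2.** The integral $$\Gamma_{\mathcal T_l^+\cdot e_\psi}(\chi_i)=\int_{\mathcal T_l^+\cdot e_\psi}e^{-\operatorname{tr}Z}\,\Delta^\psi_{\chi_i}(Z)\,\nu_\psi(dZ)$$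 converges if and only if $\lambda_j>n^i_j/2$ for all $j\in I$ with $\psi(j)=1$. In this case $$\Gamma_{\mathcal T_l^+\cdot e_\psi}(\chi_i)=2^{-|\psi|}\,\pi^{|n^\psi|/2}\prod_{j\in I,\ \psi(j)=1}\Gamma\Big(\lambda_j-\frac{n^i_j}{2}\Big).$$ -/

import Mathlib

noncomputable section

open scoped Classical

namespace Vinberg

section Algebra

variable {I : Type*} [Fintype I] [PartialOrder I]
  {A : I → I → Type*} [∀ i j, NormedAddCommGroup (A i j)] [∀ i j, InnerProductSpace ℝ (A i j)]

/-- The raw operations on a family `A i j` of matrix entries: the identification of the diagonal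
entries with `ℝ`, the adjunction `A i j → A j i`, and the partial products
`A i j × A j k → A i k`. -/
structure Ops (I : Type*) [Fintype I] [PartialOrder I] (A : I → I → Type*)
    [∀ i j, NormedAddCommGroup (A i j)] [∀ i j, InnerProductSpace ℝ (A i j)] where
  scalar : ∀ i, A i i ≃ₗ[ℝ] ℝ
  adj : ∀ i j, A i j →ₗ[ℝ] A j i
  emul : ∀ i j k, A i j →ₗ[ℝ] A j k →ₗ[ℝ] A i k

/-- The space `𝒜 = ∏_{i,j} A i j` of generalized matrices. -/
abbrev Mat {I : Type*} (A : I → I → Type*) := ∀ i j, A i j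

namespace Ops

variable (O : Ops I A)

/-- The product `(X Y)_{ij} = ∑_μ x_{iμ} y_{μj}`. -/
def mul (X Y : Mat A) : Mat A := fun i j => ∑ m, O.emul i m j (X i m) (Y m j)

/-- The adjoint matrix `X ↦ X^*`. -/
def star (X : Mat A) : Mat A := fun i j => O.adj j i (X j i)

/-- The trace `∑_i x_{ii}`. -/
def tr (X : Mat A) : ℝ := ∑ i, O.scalar i (X i i)

/-- The diagonal matrix with diagonal entries `d i`. -/
def diag (d : I → ℝ) : Mat A := fun i => Pi.single i ((O.scalar i).symm (d i))

/-- The diagonal matrix with all diagonal entries equal to `1`. -/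
def one : Mat A := O.diag fun _ => 1

end Ops

/-- The lower triangular matrices `𝒯_l`. -/
def lowerTri (A : I → I → Type*) [∀ i j, NormedAddCommGroup (A i j)] : Set (Mat A) :=
  {T | ∀ i j, ¬ j ≤ i → T i j = 0}

end Algebra

/-- A Vinberg algebra over the finite poset `I`. The spaces `A i j` and `A j i`, `j < i`, are two
copies of one space `E_{ij}`; the adjunction `A i j → A j i` carries the involution of `E_{ij}`.
The norm of `A i j` carries no extra information: by `inner_eq` it is the one given by
`‖a‖² = a a^*`. -/
structure Algebra (I : Type*) [Fintype I] [PartialOrder I] (A : I → I → Type*)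
    [∀ i j, NormedAddCommGroup (A i j)] [∀ i j, InnerProductSpace ℝ (A i j)]
    extends Ops I A where
  entry_trivial : ∀ i j, ¬ i ≤ j → ¬ j ≤ i → Subsingleton (A i j)
  entry_nontrivial : ∀ i j, j < i → Nontrivial (A i j)
  adj_adj : ∀ i j (a : A i j), adj j i (adj i j a) = a
  adj_diag : ∀ i (a : A i i), adj i i a = a
  inner_eq : ∀ i j (a b : A i j), inner ℝ a b = scalar i (emul i j i a (adj i j b))
  one_mul : ∀ X : Mat A, toOps.mul toOps.one X = X
  mul_one : ∀ X : Mat A, toOps.mul X toOps.one = X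
  tr_pos : ∀ X : Mat A, X ≠ 0 → 0 < toOps.tr (toOps.mul X (toOps.star X))
  star_mul : ∀ X Y : Mat A,
    toOps.star (toOps.mul X Y) = toOps.mul (toOps.star Y) (toOps.star X)
  tr_comm : ∀ X Y : Mat A, toOps.tr (toOps.mul X Y) = toOps.tr (toOps.mul Y X)
  tr_assoc : ∀ X Y Z : Mat A,
    toOps.tr (toOps.mul X (toOps.mul Y Z)) = toOps.tr (toOps.mul (toOps.mul X Y) Z)
  lower_assoc : ∀ U ∈ lowerTri A, ∀ S ∈ lowerTri A, ∀ T ∈ lowerTri A,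
    toOps.mul (toOps.mul S T) U = toOps.mul S (toOps.mul T U)
  lower_star_assoc : ∀ U ∈ lowerTri A, ∀ T ∈ lowerTri A,
    toOps.mul T (toOps.mul U (toOps.star U)) = toOps.mul (toOps.mul T U) (toOps.star U)

namespace Algebra

variable {I : Type*} [Fintype I] [PartialOrder I]
  {A : I → I → Type*} [∀ i j, NormedAddCommGroup (A i j)] [∀ i j, InnerProductSpace ℝ (A i j)]
  (V : Algebra I A)

/-- The group `𝒯_l^+` of lower triangular matrices with positive diagonal. -/
def lowerTriPos : Set (Mat A) := {T | T ∈ lowerTri A ∧ ∀ i, 0 < V.scalar i (T i i)}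

/-- The homogeneous cone `𝒫 = {T T^* : T ∈ 𝒯_l^+}`. -/
def cone : Set (Mat A) := {X | ∃ T ∈ V.lowerTriPos, X = V.mul T (V.star T)}

/-- The triangular factor `T ∈ 𝒯_l^+` of `X = T T^* ∈ 𝒫` (`0` outside the cone). -/
def factor (X : Mat A) : Mat A :=
  if h : X ∈ V.cone then Exists.choose h else 0

/-- The large principal minor `Δ_{≼k}(T T^*) = ∏_{j ≼ k} t_{jj}^2`. -/
def minorLE (k : I) (X : Mat A) : ℝ :=
  ∏ j with j ≤ k, V.scalar j (V.factor X j j) ^ 2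

/-- The strict principal minor `Δ_{≺k}(T T^*) = ∏_{j ≺ k} t_{jj}^2`. -/
def minorLT (k : I) (X : Mat A) : ℝ :=
  ∏ j with j < k, V.scalar j (V.factor X j j) ^ 2

/-- The generalized power `Δ_χ^{(i)}(X) = ∏_{i ≼ k} (Δ_{≼k}(X) / Δ_{≺k}(X)) ^ λ_k` of the
multiplier `χ = (λ_k)`. -/
def genPow (i : I) (χ : I → ℝ) (X : Mat A) : ℝ :=
  ∏ k with i ≤ k, (V.minorLE k X / V.minorLT k X) ^ χ k

/-- The diagonal matrix `e_ψ = diag ψ`. -/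
def ePsi (ψ : I → Fin 2) : Mat A := V.diag fun j => ((ψ j : ℕ) : ℝ)

/-- `T · e_ψ = T e_ψ T^*`. -/
def act (ψ : I → Fin 2) (T : Mat A) : Mat A := V.mul (V.mul T (V.ePsi ψ)) (V.star T)

/-- The orbit `𝒯_l^+ · e_ψ`. -/
def orbit (ψ : I → Fin 2) : Set (Mat A) := {Z | ∃ T ∈ V.lowerTriPos, Z = V.act ψ T}

/-- The generalized power on the orbit, `Δ_χ^ψ(T · e_ψ) = Δ_χ^{(i)}(T T^*)` for `T ∈ 𝒯_l^+`
(`0` outside the orbit). -/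
def orbitPow (i : I) (ψ : I → Fin 2) (χ : I → ℝ) (Z : Mat A) : ℝ :=
  if h : Z ∈ V.orbit ψ then
    V.genPow i χ (V.mul (Exists.choose h) (V.star (Exists.choose h)))
  else 0

end Algebra

section Parameters

variable {I : Type*} [Fintype I] [PartialOrder I]

/-- The set `𝒳(ψ)` of multipliers `χ_i = (λ_j)` with `λ_j = 0` if `i ⋠ j`, and also if `i ≼ j`
and `ψ j = 0`. -/
def multipliers (i : I) (ψ : I → Fin 2) : Set (I → ℝ) :=
  {χ | (∀ j, ¬ i ≤ j → χ j = 0) ∧ ∀ j, i ≤ j → ψ j = 0 → χ j = 0}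

/-- `n_j^i = ∑_{k ≺ j} ψ(k) dim E_{jk}`. -/
def nPsi (A : I → I → Type*) [∀ i j, NormedAddCommGroup (A i j)]
    [∀ i j, InnerProductSpace ℝ (A i j)] (ψ : I → Fin 2) (j : I) : ℕ :=
  ∑ k with k < j, (ψ k : ℕ) * Module.finrank ℝ (A j k)

/-- `|ψ| = ∑_{i ≼ j} ψ(j)`. -/
def absPsi (i : I) (ψ : I → Fin 2) : ℕ := ∑ j with i ≤ j, (ψ j : ℕ)

/-- `|n^ψ| = ∑_{i ≼ j} n_j^i`. -/
def absN (A : I → I → Type*) [∀ i j, NormedAddCommGroup (A i j)]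
    [∀ i j, InnerProductSpace ℝ (A i j)] (i : I) (ψ : I → Fin 2) : ℕ :=
  ∑ j with i ≤ j, nPsi A ψ j

/-- The multiplier with `λ_j = -ψ(j) (1 + n_j^i) / 2` if `i ≼ j` and `λ_j = 0` otherwise. -/
def dotChi (A : I → I → Type*) [∀ i j, NormedAddCommGroup (A i j)]
    [∀ i j, InnerProductSpace ℝ (A i j)] (i : I) (ψ : I → Fin 2) (j : I) : ℝ :=
  if i ≤ j then -((ψ j : ℕ) : ℝ) * (1 + (nPsi A ψ j : ℝ)) / 2 else 0

/-- The index set `{(k, j) : i ≼ j ≼ k, ψ(j) = 1}` of the coordinates `t_{kj}`. -/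
abbrev CoordIdx (i : I) (ψ : I → Fin 2) : Type _ :=
  {p : I × I // i ≤ p.2 ∧ p.2 ≤ p.1 ∧ ψ p.2 = 1}

/-- The space of the coordinates `t_{kj}`, `i ≼ j ≼ k`, `ψ(j) = 1`. -/
abbrev Coord (A : I → I → Type*) (i : I) (ψ : I → Fin 2) : Type _ :=
  ∀ p : CoordIdx i ψ, A p.1.1 p.1.2

end Parameters

namespace Algebra

variable {I : Type*} [Fintype I] [PartialOrder I]
  {A : I → I → Type*} [∀ i j, NormedAddCommGroup (A i j)] [∀ i j, InnerProductSpace ℝ (A i j)]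
  (V : Algebra I A)

/-- The matrix with the given coordinates `t_{kj}`, `i ≼ j ≼ k`, `ψ(j) = 1`, and with the entries
of the unit matrix elsewhere. (If `ψ` vanishes off `{j : i ≼ j}`, then `T · e_ψ` does not depend
on the other entries of the lower triangular matrix `T`.) -/
def ofCoord (i : I) (ψ : I → Fin 2) (t : Coord A i ψ) : Mat A :=
  fun k j => if h : i ≤ j ∧ j ≤ k ∧ ψ j = 1 then t ⟨(k, j), h⟩ else V.one k j

/-- The coordinates with `t_{jj} > 0` for all `j` with `i ≼ j` and `ψ(j) = 1`. -/
def posCoord (i : I) (ψ : I → Fin 2) : Set (Coord A i ψ) :=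
  {t | ∀ j (hi : i ≤ j) (hψ : ψ j = 1), 0 < V.scalar j (t ⟨(j, j), hi, le_refl j, hψ⟩)}

/-- The measure `ν_ψ(d(T · e_ψ)) = Δ_{χ̇}^{(i)}(T T^*) ∏_{i ≼ j ≼ k, ψ(j) = 1} dt_{kj}` on the
orbit of `e_ψ` if `ψ ≠ 0`, and the Dirac measure at `0` if `ψ = 0`. Here `dt_{kj}` is the Lebesgue
measure of the Euclidean space `A k j`. -/
def nu [∀ i j, FiniteDimensional ℝ (A i j)] [∀ i j, MeasurableSpace (A i j)]
    [∀ i j, BorelSpace (A i j)] (i : I) (ψ : I → Fin 2) : MeasureTheory.Measure (Mat A) :=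
  if ψ = 0 then MeasureTheory.Measure.dirac 0
  else
    (((MeasureTheory.volume : MeasureTheory.Measure (Coord A i ψ)).restrict
      (V.posCoord i ψ)).withDensity fun t => ENNReal.ofReal
        (V.genPow i (dotChi A i ψ) (V.mul (V.ofCoord i ψ t) (V.star (V.ofCoord i ψ t))))).map
      fun t => V.act ψ (V.ofCoord i ψ t)

end Algebra

end Vinberg

end

noncomputable section

open scoped Classical
open MeasureTheory

section Prelim

/-- Tonelli's theorem for a product of functions of one variable each, indexed by `Fin n`. -/
theorem lintegral_fin_prod_eq_prod {n : ℕ} {E : Fin n → Type*}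
    {mE : ∀ i, MeasurableSpace (E i)} {μ : (i : Fin n) → Measure (E i)} [∀ i, SigmaFinite (μ i)]
    {f : (i : Fin n) → E i → ENNReal} (hf : ∀ i, Measurable (f i)) :
    ∫⁻ x : (i : Fin n) → E i, ∏ i, f i (x i) ∂(Measure.pi μ) = ∏ i, ∫⁻ x, f i x ∂(μ i) := by
  induction n with
  | zero => simp
  | succ n n_ih =>
    rw [← ((measurePreserving_piFinSuccAbove μ 0).symm).lintegral_comp_emb
      (MeasurableEquiv.measurableEmbedding _)]
    simp_rw [MeasurableEquiv.piFinSuccAbove_symm_apply, Fin.insertNthEquiv,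
      Fin.prod_univ_succ, Fin.insertNth_zero]
    simp only [Fin.zero_succAbove]
    rw [← n_ih fun i => hf i.succ]
    exact lintegral_prod_mul (μ := μ 0) (ν := Measure.pi fun j : Fin n => μ j.succ) (hf 0).aemeasurable
      (Finset.measurable_prod _ fun (i : Fin n) _ =>
        (hf i.succ).comp (measurable_pi_apply i)).aemeasurable

/-- Tonelli's theorem for a product of functions of one variable each. -/
theorem lintegral_fintype_prod_eq_prod {ι : Type*} [Fintype ι] {E : ι → Type*}
    {mE : ∀ i, MeasurableSpace (E i)} {μ : (i : ι) → Measure (E i)} [∀ i, SigmaFinite (μ i)]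
    {f : (i : ι) → E i → ENNReal} (hf : ∀ i, Measurable (f i)) :
    ∫⁻ x : (i : ι) → E i, ∏ i, f i (x i) ∂(Measure.pi μ) = ∏ i, ∫⁻ x, f i x ∂(μ i) := by
  let e := (Fintype.equivFin ι).symm
  rw [← (measurePreserving_piCongrLeft _ e).lintegral_comp_emb
    (MeasurableEquiv.measurableEmbedding _)]
  simp_rw [← e.prod_comp, MeasurableEquiv.coe_piCongrLeft, Equiv.piCongrLeft_apply_apply]
  exact lintegral_fin_prod_eq_prod fun i => hf _

/-- A product of functions of one variable each, none of them a.e. zero, is integrable if and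
only if every factor is. -/
theorem integrable_fintype_prod_iff {ι : Type*} [Fintype ι] {E : ι → Type*}
    {mE : ∀ i, MeasurableSpace (E i)} {μ : (i : ι) → Measure (E i)} [∀ i, SigmaFinite (μ i)]
    {f : (i : ι) → E i → ℝ} (hf : ∀ i, Measurable (f i)) (h0 : ∀ i, ¬ f i =ᵐ[μ i] 0) :
    Integrable (fun x : (i : ι) → E i => ∏ i, f i (x i)) (Measure.pi μ) ↔
      ∀ i, Integrable (f i) (μ i) := by
  refine ⟨fun h => ?_, fun h => Integrable.fintype_prod_dep h⟩
  have h2 : ∫⁻ x : (i : ι) → E i, ∏ i, ‖f i (x i)‖ₑ ∂(Measure.pi μ) < ⊤ := by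
    simpa only [HasFiniteIntegral, enorm, nnnorm_prod, ENNReal.ofNNReal_finsetProd] using h.2
  rw [lintegral_fintype_prod_eq_prod fun i => (hf i).enorm] at h2
  intro i
  refine ⟨(hf i).aestronglyMeasurable, lt_top_iff_ne_top.2 fun hi => ?_⟩
  refine h2.ne (WithTop.prod_eq_top (Finset.mem_univ i) hi fun j _ hj => h0 j ?_)
  filter_upwards [(lintegral_eq_zero_iff (hf j).enorm).1 hj] with x hx
  simpa using hx

/-- A Borel map that is injective on a Borel set restricts to a measurable embedding of it. -/
theorem measurableEmbedding_restrict_of_injOn {X Y : Type*} [MeasurableSpace X]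
    [StandardBorelSpace X] [MeasurableSpace Y] [MeasurableSpace.CountablySeparated Y]
    {F : X → Y} (hF : Measurable F) {P : Set X} (hP : MeasurableSet P) (hinj : Set.InjOn F P) :
    MeasurableEmbedding (fun x : P => F x) := by
  have : StandardBorelSpace P := hP.standardBorel
  exact (hF.comp measurable_subtype_coe).measurableEmbedding hinj.injective

theorem map_eq_map_subtype {X Y : Type*} [MeasurableSpace X] [MeasurableSpace Y]
    {F : X → Y} (hF : Measurable F) {P : Set X} (hP : MeasurableSet P) {μ : Measure X}
    (hμ : ∀ᵐ x ∂μ, x ∈ P) :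
    μ.map F = (μ.comap ((↑) : P → X)).map (fun x : P => F x) := by
  have h : (μ.comap ((↑) : P → X)).map (↑) = μ := by
    rw [map_comap_subtype_coe hP, Measure.restrict_eq_self_of_ae_mem hμ]
  conv_lhs => rw [← h]
  exact Measure.map_map hF measurable_subtype_coe

section ChangeOfVariables

variable {X Y : Type*} [MeasurableSpace X] [StandardBorelSpace X] [MeasurableSpace Y]
  [MeasurableSpace.CountablySeparated Y] {F : X → Y} {P : Set X} {μ : Measure X}

/-- Change of variables for a Borel map that is injective on a conull Borel set: no measurability
of the integrand is needed. -/
theorem integrable_map_iff_of_injOn (hF : Measurable F) (hP : MeasurableSet P)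
    (hinj : Set.InjOn F P) (hμ : ∀ᵐ x ∂μ, x ∈ P) (f : Y → ℝ) :
    Integrable f (μ.map F) ↔ Integrable (fun x => f (F x)) μ := by
  rw [map_eq_map_subtype hF hP hμ,
    (measurableEmbedding_restrict_of_injOn hF hP hinj).integrable_map_iff]
  conv_rhs => rw [← Measure.restrict_eq_self_of_ae_mem hμ, ← map_comap_subtype_coe hP,
    (MeasurableEmbedding.subtype_coe hP).integrable_map_iff]
  rfl

theorem integral_map_of_injOn (hF : Measurable F) (hP : MeasurableSet P)
    (hinj : Set.InjOn F P) (hμ : ∀ᵐ x ∂μ, x ∈ P) (f : Y → ℝ) :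
    ∫ y, f y ∂(μ.map F) = ∫ x, f (F x) ∂μ := by
  rw [map_eq_map_subtype hF hP hμ,
    (measurableEmbedding_restrict_of_injOn hF hP hinj).integral_map]
  conv_rhs => rw [← Measure.restrict_eq_self_of_ae_mem hμ, ← map_comap_subtype_coe hP,
    (MeasurableEmbedding.subtype_coe hP).integral_map]

theorem ae_mem_map_of_injOn (hF : Measurable F) (hP : MeasurableSet P)
    (hinj : Set.InjOn F P) (hμ : ∀ᵐ x ∂μ, x ∈ P) {s : Set Y} (hs : Set.MapsTo F P s) :
    ∀ᵐ y ∂(μ.map F), y ∈ s := by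
  rw [map_eq_map_subtype hF hP hμ,
    (measurableEmbedding_restrict_of_injOn hF hP hinj).ae_map_iff]
  exact Filter.Eventually.of_forall fun x => hs x.2

end ChangeOfVariables

/-- `s ↦ e^{-s²} s^q` on the half-line. -/
theorem integrableOn_exp_neg_sq_mul_rpow_iff (q : ℝ) :
    IntegrableOn (fun s : ℝ => Real.exp (-s ^ 2) * s ^ q) (Set.Ioi 0) ↔ -1 < q := by
  constructor
  · intro h
    have h1 : IntegrableOn (fun s : ℝ => Real.exp (-s ^ 2) * s ^ q) (Set.Ioo 0 1) :=
      h.mono_set Set.Ioo_subset_Ioi_self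
    rw [← intervalIntegral.integrableOn_Ioo_rpow_iff (s := q) one_pos]
    refine (h1.const_mul (Real.exp 1)).mono'
      (measurable_id'.pow_const q).aestronglyMeasurable ?_
    refine (ae_restrict_iff' measurableSet_Ioo).2 (Filter.Eventually.of_forall fun s hs => ?_)
    have hpos : 0 ≤ s ^ q := Real.rpow_nonneg hs.1.le q
    rw [Real.norm_of_nonneg hpos, ← mul_assoc, ← Real.exp_add]
    refine le_mul_of_one_le_left hpos (Real.one_le_exp ?_)
    nlinarith [hs.1, hs.2]
  · intro h
    refine (integrableOn_rpow_mul_exp_neg_rpow h two_pos).congr_fun (fun s _ => ?_)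
      measurableSet_Ioi
    simp [mul_comm]

theorem integral_exp_neg_sq_mul_rpow {q : ℝ} (hq : -1 < q) :
    ∫ s in Set.Ioi (0 : ℝ), Real.exp (-s ^ 2) * s ^ q = 2⁻¹ * Real.Gamma ((q + 1) / 2) := by
  rw [← one_div, ← integral_rpow_mul_exp_neg_rpow two_pos hq]
  exact setIntegral_congr_fun measurableSet_Ioi fun s _ => by simp [mul_comm]

theorem integrable_exp_neg_norm_sq (E : Type*) [NormedAddCommGroup E] [InnerProductSpace ℝ E]
    [FiniteDimensional ℝ E] [MeasurableSpace E] [BorelSpace E] :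
    Integrable (fun v : E => Real.exp (-‖v‖ ^ 2)) := by
  by_contra h
  have := GaussianFourier.integral_rexp_neg_mul_sq_norm (V := E) one_pos
  simp only [neg_mul, one_mul, div_one] at this
  rw [integral_undef h] at this
  exact (Real.rpow_pos_of_pos Real.pi_pos _).ne this

theorem integral_exp_neg_norm_sq (E : Type*) [NormedAddCommGroup E] [InnerProductSpace ℝ E]
    [FiniteDimensional ℝ E] [MeasurableSpace E] [BorelSpace E] :
    ∫ v : E, Real.exp (-‖v‖ ^ 2) = Real.pi ^ (Module.finrank ℝ E / 2 : ℝ) := by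
  simpa using GaussianFourier.integral_rexp_neg_mul_sq_norm (V := E) one_pos

end Prelim

namespace Vinberg

namespace Algebra

variable {I : Type*} [Fintype I] [PartialOrder I]
  {A : I → I → Type*} [∀ i j, NormedAddCommGroup (A i j)] [∀ i j, InnerProductSpace ℝ (A i j)]
  (V : Algebra I A)

theorem diag_self (d : I → ℝ) (i : I) : V.diag d i i = (V.scalar i).symm (d i) := by
  simp [Ops.diag]

theorem diag_of_ne (d : I → ℝ) {i j : I} (h : i ≠ j) : V.diag d i j = 0 := by
  simp [Ops.diag, h.symm]

theorem emul_scalar_symm (i j : I) (a : A i j) (r : ℝ) :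
    V.emul i j j a ((V.scalar j).symm r) = r • a := by
  have h := congrFun₂ (V.mul_one (Pi.single i (Pi.single j a))) i j
  simp only [Ops.mul, Ops.one] at h
  rw [Finset.sum_eq_single j (fun m _ hm => by simp [V.diag_of_ne _ hm]) (by simp)] at h
  simp only [Pi.single_eq_same, V.diag_self] at h
  have hr : (V.scalar j).symm r = r • (V.scalar j).symm 1 := by simp [← map_smul]
  rw [hr, map_smul, h]

theorem emul_diag_entry (i j : I) (a : A i j) (b : A j j) :
    V.emul i j j a b = V.scalar j b • a := by
  rw [← V.emul_scalar_symm, LinearEquiv.symm_apply_apply]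

theorem mul_diag_apply (X : Mat A) (d : I → ℝ) (i j : I) :
    V.mul X (V.diag d) i j = d j • X i j := by
  rw [Ops.mul, Finset.sum_eq_single j (fun m _ hm => by simp [V.diag_of_ne _ hm]) (by simp),
    V.diag_self, V.emul_scalar_symm]

theorem act_apply (ψ : I → Fin 2) (T : Mat A) (k l : I) :
    V.act ψ T k l =
      ∑ m, ((ψ m : ℕ) : ℝ) • V.emul k m l (T k m) (V.adj l m (T l m)) := by
  simp only [act, ePsi]
  rw [Ops.mul]
  exact Finset.sum_congr rfl fun m _ => by rw [V.mul_diag_apply]; simp [Ops.star]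

theorem act_one (T : Mat A) : V.act (fun _ => 1) T = V.mul T (V.star T) := by
  have : V.ePsi (fun _ => 1) = V.one := by simp [ePsi, Ops.one]
  rw [act, this, V.mul_one]

theorem norm_sq_eq (i j : I) (a : A i j) :
    V.scalar i (V.emul i j i a (V.adj i j a)) = ‖a‖ ^ 2 := by
  rw [← V.inner_eq, real_inner_self_eq_norm_sq]

theorem norm_eq_abs_scalar (i : I) (a : A i i) : ‖a‖ = |V.scalar i a| := by
  rw [← sq_eq_sq₀ (norm_nonneg _) (abs_nonneg _), ← V.norm_sq_eq, V.adj_diag, V.emul_diag_entry,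
    map_smul, smul_eq_mul, sq_abs, sq]

theorem tr_act (ψ : I → Fin 2) (T : Mat A) :
    V.tr (V.act ψ T) = ∑ k, ∑ m, ((ψ m : ℕ) : ℝ) * ‖T k m‖ ^ 2 := by
  simp only [Ops.tr, V.act_apply, map_sum, map_smul, V.norm_sq_eq, smul_eq_mul]

/-- `T · e_ψ` determines the columns `j` with `ψ j = 1` of the triangular matrix `T`. -/
theorem column_eq_of_act_eq {ψ : I → Fin 2} {S T : Mat A} (hS : S ∈ lowerTri A)
    (hT : T ∈ lowerTri A) (hSp : ∀ j, ψ j = 1 → 0 < V.scalar j (S j j))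
    (hTp : ∀ j, ψ j = 1 → 0 < V.scalar j (T j j)) (h : V.act ψ S = V.act ψ T)
    (j : I) (hj : ψ j = 1) (k : I) : S k j = T k j := by
  induction j using WellFoundedLT.induction generalizing k with
  | ind j ih =>
  have key (k : I) : V.scalar j (S j j) • S k j = V.scalar j (T j j) • T k j := by
    have h1 := congrFun₂ h k j
    rw [V.act_apply, V.act_apply, ← Finset.add_sum_erase _ _ (Finset.mem_univ j),
      ← Finset.add_sum_erase Finset.univ (fun m => ((ψ m : ℕ) : ℝ) •
        V.emul k m j (T k m) (V.adj j m (T j m))) (Finset.mem_univ j)] at h1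
    rw [Finset.sum_congr rfl (g := fun m =>
      ((ψ m : ℕ) : ℝ) • V.emul k m j (T k m) (V.adj j m (T j m)))] at h1
    · simpa only [hj, V.adj_diag, V.emul_diag_entry, Fin.val_one, Nat.cast_one, one_smul,
        add_left_inj] using h1
    · intro m hm
      by_cases hmj : m ≤ j
      · by_cases hm1 : ψ m = 1
        · have hlt := lt_of_le_of_ne hmj (Finset.ne_of_mem_erase hm)
          rw [ih m hlt hm1, ih m hlt hm1]
        · have : ψ m = 0 := by omega
          simp [this]
      · rw [hS j m hmj, hT j m hmj]; simp
  have hd : V.scalar j (S j j) = V.scalar j (T j j) := by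
    have := congrArg (V.scalar j) (key j)
    simp only [map_smul, smul_eq_mul] at this
    exact (mul_self_inj (hSp j hj).le (hTp j hj).le).1 this
  have hk := key k
  rw [hd] at hk
  exact smul_right_injective _ (hTp j hj).ne' hk

theorem factor_mul_star {T : Mat A} (hT : T ∈ V.lowerTriPos) :
    V.factor (V.mul T (V.star T)) = T := by
  have h : V.mul T (V.star T) ∈ V.cone := ⟨T, hT, rfl⟩
  rw [factor, dif_pos h]
  obtain ⟨hc, he⟩ := Exists.choose_spec h
  have he := (V.act_one T).trans (he.trans (V.act_one _).symm)
  funext k j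
  exact (V.column_eq_of_act_eq hT.1 hc.1 (fun j _ => hT.2 j) (fun j _ => hc.2 j) he j rfl k).symm

theorem genPow_mul_star {T : Mat A} (hT : T ∈ V.lowerTriPos) (i : I) (χ : I → ℝ) :
    V.genPow i χ (V.mul T (V.star T)) =
      ∏ k with i ≤ k, (V.scalar k (T k k) ^ 2) ^ χ k := by
  refine Finset.prod_congr rfl fun k _ => ?_
  have hs : (Finset.univ.filter fun j : I => j ≤ k) =
      insert k (Finset.univ.filter fun j : I => j < k) := by
    ext j; simp [le_iff_eq_or_lt]
  rw [minorLE, minorLT, V.factor_mul_star hT, hs, Finset.prod_insert (by simp),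
    mul_div_cancel_right₀]
  exact Finset.prod_ne_zero_iff.2 fun j _ => (pow_pos (hT.2 j) 2).ne'

/-- `Δ^ψ_χ(T · e_ψ) = Δ^{(i)}_χ(T T^*)`. -/
theorem orbitPow_act {i : I} {ψ : I → Fin 2} {χ : I → ℝ} (hχ : χ ∈ multipliers i ψ)
    {T : Mat A} (hT : T ∈ V.lowerTriPos) :
    V.orbitPow i ψ χ (V.act ψ T) = ∏ k with i ≤ k, (V.scalar k (T k k) ^ 2) ^ χ k := by
  have h : V.act ψ T ∈ V.orbit ψ := ⟨T, hT, rfl⟩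
  rw [orbitPow, dif_pos h]
  obtain ⟨hc, he⟩ := Exists.choose_spec h
  rw [V.genPow_mul_star hc]
  refine Finset.prod_congr rfl fun k hk => ?_
  by_cases hk1 : ψ k = 1
  · rw [V.column_eq_of_act_eq hT.1 hc.1 (fun j _ => hT.2 j) (fun j _ => hc.2 j) he k hk1 k]
  · rw [hχ.2 k (by simpa using hk) (by omega), Real.rpow_zero, Real.rpow_zero]

end Algebra

section Coordinates

variable {I : Type*} [Fintype I] [PartialOrder I]

@[to_additive]
theorem prod_coordIdx {M : Type*} [CommMonoid M] {i : I} {ψ : I → Fin 2}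
    (hψ : ∀ j, ¬ i ≤ j → ψ j = 0) (f : I → I → M) :
    ∏ p : CoordIdx i ψ, f p.1.1 p.1.2 =
      ∏ j with ψ j = 1, ∏ k with j ≤ k, f k j := by
  rw [← Finset.prod_subtype
    (Finset.univ.filter fun p : I × I => i ≤ p.2 ∧ p.2 ≤ p.1 ∧ ψ p.2 = 1) (by simp)
    (fun p => f p.1 p.2), Finset.prod_filter, Fintype.prod_prod_type_right, Finset.prod_filter]
  refine Finset.prod_congr rfl fun j _ => ?_
  by_cases hj : ψ j = 1
  · have hij : i ≤ j := by
      by_contra h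
      simp [hψ j h] at hj
    rw [if_pos hj, Finset.prod_filter]
    simp [hj, hij]
  · simp [hj]

/-- The diagonal factors split off. -/
theorem prod_coordIdx_eq_diag_mul {M : Type*} [CommMonoid M] {i : I} {ψ : I → Fin 2}
    (hψ : ∀ j, ¬ i ≤ j → ψ j = 0) (f : I → I → M) :
    ∏ p : CoordIdx i ψ, f p.1.1 p.1.2 =
      (∏ j with ψ j = 1, f j j) * ∏ j with ψ j = 1, ∏ k with j < k, f k j := by
  rw [prod_coordIdx hψ, ← Finset.prod_mul_distrib]
  refine Finset.prod_congr rfl fun j _ => ?_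
  have hs : (Finset.univ.filter fun k : I => j ≤ k) =
      insert j (Finset.univ.filter fun k : I => j < k) := by
    ext k; simp [le_iff_eq_or_lt, eq_comm]
  rw [hs, Finset.prod_insert (by simp)]

variable (A : I → I → Type*) [∀ i j, NormedAddCommGroup (A i j)]
  [∀ i j, InnerProductSpace ℝ (A i j)]

theorem absPsi_eq_card {i : I} {ψ : I → Fin 2} (hψ : ∀ j, ¬ i ≤ j → ψ j = 0) :
    absPsi i ψ = (Finset.univ.filter fun j => ψ j = 1).card := by
  rw [absPsi, Finset.card_filter, Finset.sum_filter]
  refine Finset.sum_congr rfl fun j _ => ?_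
  by_cases hj : ψ j = 1
  · have hij : i ≤ j := by
      by_contra h
      simp [hψ j h] at hj
    simp [hj, hij]
  · have : ψ j = 0 := by omega
    simp [this]

theorem absN_eq_sum {i : I} {ψ : I → Fin 2} (hψ : ∀ j, ¬ i ≤ j → ψ j = 0) :
    absN A i ψ = ∑ j with ψ j = 1, ∑ k with j < k, Module.finrank ℝ (A k j) := by
  simp only [absN, nPsi, Finset.sum_filter]
  calc _ = ∑ k, ∑ j, if ψ j = 1 ∧ j < k then Module.finrank ℝ (A k j) else 0 := by
        refine Finset.sum_congr rfl fun k _ => ?_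
        by_cases hk : i ≤ k
        · rw [if_pos hk]
          refine Finset.sum_congr rfl fun j _ => ?_
          obtain hj | hj : ψ j = 1 ∨ ψ j = 0 := by omega
          all_goals simp [hj]
        · rw [if_neg hk]
          refine (Finset.sum_eq_zero fun j _ => if_neg fun h => ?_).symm
          have := hψ j fun hij => hk (hij.trans h.2.le)
          simp [this] at h
    _ = _ := by
        rw [Finset.sum_comm]
        refine Finset.sum_congr rfl fun j _ => ?_
        by_cases hj : ψ j = 1 <;> simp [hj]

end Coordinates

namespace Algebra

variable {I : Type*} [Fintype I] [PartialOrder I]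
  {A : I → I → Type*} [∀ i j, NormedAddCommGroup (A i j)] [∀ i j, InnerProductSpace ℝ (A i j)]
  (V : Algebra I A)

theorem one_of_ne {i j : I} (h : i ≠ j) : V.one i j = 0 := V.diag_of_ne _ h

theorem scalar_one (i : I) : V.scalar i (V.one i i) = 1 := by
  rw [Ops.one, V.diag_self, LinearEquiv.apply_symm_apply]

theorem one_mem_lowerTriPos : V.one ∈ V.lowerTriPos :=
  ⟨fun i j h => V.one_of_ne fun e => h e.ge, fun i => by rw [V.scalar_one]; exact one_pos⟩

theorem ofCoord_coe {i : I} {ψ : I → Fin 2} (t : Coord A i ψ) (p : CoordIdx i ψ) :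
    V.ofCoord i ψ t p.1.1 p.1.2 = t p := by
  rw [ofCoord, dif_pos p.2]

theorem ofCoord_of_ne_one {i : I} {ψ : I → Fin 2} (t : Coord A i ψ) {j : I} (hj : ψ j ≠ 1)
    (k : I) : V.ofCoord i ψ t k j = V.one k j := by
  rw [ofCoord, dif_neg fun h => hj h.2.2]

theorem ofCoord_mem_lowerTri {i : I} {ψ : I → Fin 2} (t : Coord A i ψ) :
    V.ofCoord i ψ t ∈ lowerTri A := fun k j h => by
  rw [ofCoord, dif_neg fun h' => h h'.2.1]
  exact V.one_of_ne fun e => h e.ge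

theorem ofCoord_mem_lowerTriPos {i : I} {ψ : I → Fin 2} {t : Coord A i ψ}
    (ht : t ∈ V.posCoord i ψ) : V.ofCoord i ψ t ∈ V.lowerTriPos := by
  refine ⟨V.ofCoord_mem_lowerTri t, fun j => ?_⟩
  by_cases h : i ≤ j ∧ j ≤ j ∧ ψ j = 1
  · rw [ofCoord, dif_pos h]; exact ht j h.1 h.2.2
  · rw [ofCoord, dif_neg h, V.scalar_one]; exact one_pos

theorem injOn_act_ofCoord (i : I) (ψ : I → Fin 2) :
    Set.InjOn (fun t => V.act ψ (V.ofCoord i ψ t)) (V.posCoord i ψ) := by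
  intro s hs t ht h
  funext p
  rw [← V.ofCoord_coe s, ← V.ofCoord_coe t]
  exact V.column_eq_of_act_eq (V.ofCoord_mem_lowerTri s) (V.ofCoord_mem_lowerTri t)
    (fun j _ => (V.ofCoord_mem_lowerTriPos hs).2 j)
    (fun j _ => (V.ofCoord_mem_lowerTriPos ht).2 j) h _ p.2.2.2 _

theorem tr_act_ofCoord {i : I} {ψ : I → Fin 2} (hψ : ∀ j, ¬ i ≤ j → ψ j = 0)
    (t : Coord A i ψ) :
    V.tr (V.act ψ (V.ofCoord i ψ t)) = ∑ p, ‖t p‖ ^ 2 := by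
  simp_rw [V.tr_act, ← V.ofCoord_coe t]
  rw [sum_coordIdx hψ fun k j => ‖V.ofCoord i ψ t k j‖ ^ 2, Finset.sum_comm, Finset.sum_filter]
  refine Finset.sum_congr rfl fun j _ => ?_
  by_cases hj : ψ j = 1
  · rw [if_pos hj, Finset.sum_filter]
    refine Finset.sum_congr rfl fun k _ => ?_
    split_ifs with hjk
    · simp [hj]
    · simp [V.ofCoord_mem_lowerTri t k j hjk]
  · have : ψ j = 0 := by omega
    simp [this]

/-- Only the coordinates `t_{jj}` with `ψ j = 1` contribute to the generalized powers. -/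
theorem prod_scalar_ofCoord {i : I} {ψ : I → Fin 2} (hψ : ∀ j, ¬ i ≤ j → ψ j = 0)
    (t : Coord A i ψ) (χ : I → ℝ) :
    ∏ k with i ≤ k, (V.scalar k (V.ofCoord i ψ t k k) ^ 2) ^ χ k =
      ∏ k with ψ k = 1, (V.scalar k (V.ofCoord i ψ t k k) ^ 2) ^ χ k := by
  rw [Finset.prod_filter, Finset.prod_filter]
  refine Finset.prod_congr rfl fun k _ => ?_
  by_cases hk : ψ k = 1
  · have hik : i ≤ k := by
      by_contra h
      simp [hψ k h] at hk
    simp [hk, hik]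
  · simp [hk, V.ofCoord_of_ne_one t hk, V.scalar_one]

/-- The factor `s_+ ^ q` of a diagonal entry `s`; the factor `1` of an off-diagonal entry. -/
def entryWeight (q : I → ℝ) (k j : I) (a : A k j) : ℝ :=
  if h : k = j then
    (Set.Ioi (0 : ℝ)).indicator (fun s => s ^ q j) (V.scalar j (cast (by rw [h]) a))
  else 1

theorem entryWeight_self (q : I → ℝ) (j : I) (a : A j j) :
    V.entryWeight q j j a = (Set.Ioi (0 : ℝ)).indicator (fun s => s ^ q j) (V.scalar j a) := by
  rw [entryWeight, dif_pos rfl]; rfl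

theorem entryWeight_of_ne (q : I → ℝ) {k j : I} (h : k ≠ j) (a : A k j) :
    V.entryWeight q k j a = 1 := by
  rw [entryWeight, dif_neg h]

/-- The exponent `2 λ_j - 1 - n_j` of `t_{jj}` in the integrand. -/
def diagExponent (A : I → I → Type*) [∀ i j, NormedAddCommGroup (A i j)]
    [∀ i j, InnerProductSpace ℝ (A i j)] (ψ : I → Fin 2) (χ : I → ℝ) (j : I) : ℝ :=
  2 * χ j - 1 - nPsi A ψ j

/-- The integrand, in coordinates, is a product of functions of one coordinate each. -/
theorem indicator_integrand_eq_prod {i : I} {ψ : I → Fin 2} (hψ : ∀ j, ¬ i ≤ j → ψ j = 0)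
    {χ : I → ℝ} (hχ : χ ∈ multipliers i ψ) (t : Coord A i ψ) :
    (V.posCoord i ψ).indicator (fun t =>
      V.genPow i (dotChi A i ψ) (V.mul (V.ofCoord i ψ t) (V.star (V.ofCoord i ψ t))) *
      (Real.exp (-V.tr (V.act ψ (V.ofCoord i ψ t))) *
        V.orbitPow i ψ χ (V.act ψ (V.ofCoord i ψ t)))) t =
    ∏ p : CoordIdx i ψ,
      Real.exp (-‖t p‖ ^ 2) * V.entryWeight (diagExponent A ψ χ) p.1.1 p.1.2 (t p) := by
  have hw : ∏ p : CoordIdx i ψ, V.entryWeight (diagExponent A ψ χ) p.1.1 p.1.2 (t p) =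
      ∏ j with ψ j = 1, V.entryWeight (diagExponent A ψ χ) j j (V.ofCoord i ψ t j j) := by
    simp_rw [← V.ofCoord_coe t]
    rw [prod_coordIdx_eq_diag_mul hψ fun k j =>
      V.entryWeight (diagExponent A ψ χ) k j (V.ofCoord i ψ t k j)]
    convert _root_.mul_one _
    refine Finset.prod_eq_one fun j _ => Finset.prod_eq_one fun k hk => ?_
    exact V.entryWeight_of_ne _ (Finset.mem_filter.1 hk).2.ne' _
  rw [Finset.prod_mul_distrib, ← Real.exp_sum, Finset.sum_neg_distrib, ← V.tr_act_ofCoord hψ, hw]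
  by_cases ht : t ∈ V.posCoord i ψ
  · have hT := V.ofCoord_mem_lowerTriPos ht
    rw [Set.indicator_of_mem ht, V.genPow_mul_star hT, V.orbitPow_act hχ hT,
      V.prod_scalar_ofCoord hψ, V.prod_scalar_ofCoord hψ, mul_left_comm,
      ← Finset.prod_mul_distrib]
    congr 1
    refine Finset.prod_congr rfl fun j hj => ?_
    have hj1 : ψ j = 1 := (Finset.mem_filter.1 hj).2
    have hij : i ≤ j := by
      by_contra h
      simp [hψ j h] at hj1
    have hs := hT.2 j
    rw [V.entryWeight_self, Set.indicator_of_mem (Set.mem_Ioi.2 hs),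
      ← Real.rpow_add (pow_pos hs 2), ← Real.rpow_natCast, ← Real.rpow_mul hs.le]
    congr 1
    simp only [dotChi, diagExponent, if_pos hij, hj1]
    push_cast
    simp
    ring
  · rw [Set.indicator_of_notMem ht]
    symm
    simp only [posCoord, Set.mem_ofPred_eq, not_forall] at ht
    obtain ⟨j, hi, hj, hn⟩ := ht
    refine mul_eq_zero_of_right _ (Finset.prod_eq_zero (i := j) (by simp [hj]) ?_)
    rw [V.entryWeight_self, Set.indicator_of_notMem]
    rwa [ofCoord, dif_pos ⟨hi, le_refl j, hj⟩]

theorem continuous_ofCoord (i : I) (ψ : I → Fin 2) : Continuous (V.ofCoord i ψ) := by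
  refine continuous_pi fun k => continuous_pi fun j => ?_
  unfold ofCoord
  split_ifs with h
  · exact continuous_apply _
  · exact continuous_const

/-- The identification of a diagonal entry with a real number is isometric. -/
def scalarIsometry (j : I) : A j j ≃ₗᵢ[ℝ] ℝ where
  toLinearEquiv := V.scalar j
  norm_map' a := (V.norm_eq_abs_scalar j a).symm

/-- The factor of one coordinate in the integrand. -/
def entryFactor (q : I → ℝ) (k j : I) (a : A k j) : ℝ :=
  Real.exp (-‖a‖ ^ 2) * V.entryWeight q k j a

theorem entryFactor_self (q : I → ℝ) (j : I) :
    V.entryFactor q j j = fun a => (Set.Ioi (0 : ℝ)).indicator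
      (fun s => Real.exp (-s ^ 2) * s ^ q j) (V.scalarIsometry j a) := by
  funext a
  rw [entryFactor, V.entryWeight_self, V.norm_eq_abs_scalar, sq_abs]
  exact (Set.indicator_mul_right (i := V.scalar j a) (Set.Ioi (0 : ℝ))
    (fun s => Real.exp (-s ^ 2)) (fun s => s ^ q j)).symm

theorem entryFactor_of_ne (q : I → ℝ) {k j : I} (h : k ≠ j) :
    V.entryFactor q k j = fun a => Real.exp (-‖a‖ ^ 2) := by
  funext a
  rw [entryFactor, V.entryWeight_of_ne q h, _root_.mul_one]

theorem measurable_entryFactor [∀ i j, MeasurableSpace (A i j)] [∀ i j, BorelSpace (A i j)]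
    (q : I → ℝ) (k j : I) : Measurable (V.entryFactor q k j) := by
  by_cases h : k = j
  · subst h
    rw [V.entryFactor_self]
    have h : Measurable fun s : ℝ => Real.exp (-s ^ 2) * s ^ q k := by fun_prop
    exact (h.indicator measurableSet_Ioi).comp (V.scalarIsometry k).continuous.measurable
  · rw [V.entryFactor_of_ne q h]
    fun_prop

section Measure

variable [∀ i j, FiniteDimensional ℝ (A i j)]

theorem continuous_act (ψ : I → Fin 2) : Continuous (V.act ψ) := by
  refine continuous_pi fun k => continuous_pi fun l => ?_
  simp only [V.act_apply]
  refine continuous_finsetSum _ fun m _ => Continuous.const_smul ?_ _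
  have h1 : Continuous fun a : A k m => LinearMap.toContinuousLinearMap (V.emul k m l a) :=
    (LinearMap.toContinuousLinearMap.toLinearMap ∘ₗ V.emul k m l).continuous_of_finiteDimensional
  have h2 : Continuous (V.adj l m) := (V.adj l m).continuous_of_finiteDimensional
  exact (h1.comp ((continuous_apply m).comp (continuous_apply k))).clm_apply
    (h2.comp ((continuous_apply m).comp (continuous_apply l)))

theorem continuous_scalar (j : I) : Continuous (V.scalar j) :=
  (V.scalar j).toLinearMap.continuous_of_finiteDimensional

variable [∀ i j, MeasurableSpace (A i j)] [∀ i j, BorelSpace (A i j)]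

theorem measurableSet_posCoord (i : I) (ψ : I → Fin 2) : MeasurableSet (V.posCoord i ψ) := by
  simp only [posCoord, Set.ofPred_forall]
  refine MeasurableSet.iInter fun j => MeasurableSet.iInter fun hi => MeasurableSet.iInter
    fun hj => ?_
  exact measurableSet_lt measurable_const ((V.continuous_scalar j).measurable.comp
    (measurable_pi_apply (⟨(j, j), hi, le_refl j, hj⟩ : CoordIdx i ψ)))

theorem measurable_act_ofCoord (i : I) (ψ : I → Fin 2) :
    Measurable fun t => V.act ψ (V.ofCoord i ψ t) :=
  ((V.continuous_act ψ).comp (V.continuous_ofCoord i ψ)).measurable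

theorem integrable_entryFactor_of_ne (q : I → ℝ) {k j : I} (h : k ≠ j) :
    Integrable (V.entryFactor q k j) := by
  rw [V.entryFactor_of_ne q h]
  exact integrable_exp_neg_norm_sq _

theorem integral_entryFactor_of_ne (q : I → ℝ) {k j : I} (h : k ≠ j) :
    ∫ a, V.entryFactor q k j a = Real.pi ^ (Module.finrank ℝ (A k j) / 2 : ℝ) := by
  rw [V.entryFactor_of_ne q h]
  exact integral_exp_neg_norm_sq _

theorem integrable_entryFactor_self_iff (q : I → ℝ) (j : I) :
    Integrable (V.entryFactor q j j) ↔ -1 < q j := by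
  rw [← integrableOn_exp_neg_sq_mul_rpow_iff, ← integrable_indicator_iff measurableSet_Ioi,
    ← (V.scalarIsometry j).measurePreserving.integrable_comp_emb
      (V.scalarIsometry j).toHomeomorph.measurableEmbedding, V.entryFactor_self]
  rfl

theorem integral_entryFactor_self {q : I → ℝ} {j : I} (hq : -1 < q j) :
    ∫ a, V.entryFactor q j j a = 2⁻¹ * Real.Gamma ((q j + 1) / 2) := by
  rw [V.entryFactor_self, (V.scalarIsometry j).measurePreserving.integral_comp
    (V.scalarIsometry j).toHomeomorph.measurableEmbedding, integral_indicator measurableSet_Ioi,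
    integral_exp_neg_sq_mul_rpow hq]

theorem entryFactor_not_ae_zero (q : I → ℝ) (k j : I) : ¬ V.entryFactor q k j =ᵐ[volume] 0 := by
  intro h0
  by_cases h : k = j
  · subst h
    have h1 : volume {a : A k k | ¬ V.entryFactor q k k a = 0} = 0 := h0
    have h2 : {a : A k k | ¬ V.entryFactor q k k a = 0} = V.scalarIsometry k ⁻¹' Set.Ioi 0 := by
      ext a
      simp only [V.entryFactor_self, Set.mem_ofPred_eq, Set.mem_preimage]
      constructor
      · intro h
        by_contra hn
        exact h (Set.indicator_of_notMem hn _)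
      · intro h
        rw [Set.indicator_of_mem h]
        exact (mul_pos (Real.exp_pos _) (Real.rpow_pos_of_pos h _)).ne'
    rw [h2, (V.scalarIsometry k).measurePreserving.measure_preimage
      measurableSet_Ioi.nullMeasurableSet, Real.volume_Ioi] at h1
    exact ENNReal.top_ne_zero h1
  · have h1 := integral_congr_ae h0
    rw [V.integral_entryFactor_of_ne q h] at h1
    simp only [Pi.zero_apply, integral_zero] at h1
    exact (Real.rpow_pos_of_pos Real.pi_pos _).ne' h1

theorem integrable_prod_entryFactor_iff {i : I} {ψ : I → Fin 2} (hψ : ∀ j, ¬ i ≤ j → ψ j = 0)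
    (q : I → ℝ) :
    Integrable (fun t : Coord A i ψ => ∏ p, V.entryFactor q p.1.1 p.1.2 (t p)) ↔
      ∀ j, ψ j = 1 → -1 < q j := by
  have := integrable_fintype_prod_iff (μ := fun p : CoordIdx i ψ =>
      (volume : Measure (A p.1.1 p.1.2)))
    (f := fun p : CoordIdx i ψ => V.entryFactor q p.1.1 p.1.2)
    (fun p => V.measurable_entryFactor q _ _) (fun p => V.entryFactor_not_ae_zero q _ _)
  refine this.trans ⟨fun h j hj => ?_, fun h p => ?_⟩
  · have hij : i ≤ j := by
      by_contra h
      simp [hψ j h] at hj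
    exact (V.integrable_entryFactor_self_iff q j).1 (h ⟨(j, j), hij, le_refl j, hj⟩)
  · obtain ⟨⟨k, j⟩, hp⟩ := p
    by_cases hkj : k = j
    · subst hkj
      exact (V.integrable_entryFactor_self_iff q k).2 (h k hp.2.2)
    · exact V.integrable_entryFactor_of_ne q hkj

theorem integral_prod_entryFactor {i : I} {ψ : I → Fin 2} (hψ : ∀ j, ¬ i ≤ j → ψ j = 0)
    {q : I → ℝ} (hq : ∀ j, ψ j = 1 → -1 < q j) :
    ∫ t : Coord A i ψ, ∏ p, V.entryFactor q p.1.1 p.1.2 (t p) =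
      (2 : ℝ) ^ (-(absPsi i ψ : ℝ)) * Real.pi ^ ((absN A i ψ : ℝ) / 2) *
        ∏ j with ψ j = 1, Real.Gamma ((q j + 1) / 2) := by
  have h1 := integral_fintype_prod_volume_eq_prod
    (fun p : CoordIdx i ψ => V.entryFactor q p.1.1 p.1.2)
  rw [h1, prod_coordIdx_eq_diag_mul hψ fun k j => ∫ a, V.entryFactor q k j a,
    Finset.prod_congr rfl fun j hj =>
      V.integral_entryFactor_self (hq j (Finset.mem_filter.1 hj).2),
    Finset.prod_congr rfl fun j _ => Finset.prod_congr rfl fun k hk =>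
      V.integral_entryFactor_of_ne q (Finset.mem_filter.1 hk).2.ne',
    Finset.prod_mul_distrib, Finset.prod_const, ← absPsi_eq_card hψ, absN_eq_sum A hψ,
    Real.rpow_neg zero_le_two, Real.rpow_natCast, inv_pow, mul_right_comm]
  congr 2
  push_cast
  rw [Finset.sum_div, Real.rpow_sum_of_pos Real.pi_pos]
  refine Finset.prod_congr rfl fun j _ => ?_
  rw [Finset.sum_div, Real.rpow_sum_of_pos Real.pi_pos]

end Measure

/-- The density `Δ^{(i)}_{χ̇}(T T^*)` of `ν_ψ` in coordinates. -/
def coordDensity (i : I) (ψ : I → Fin 2) (t : Coord A i ψ) : ℝ :=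
  V.genPow i (dotChi A i ψ) (V.mul (V.ofCoord i ψ t) (V.star (V.ofCoord i ψ t)))

theorem coordDensity_nonneg {i : I} {ψ : I → Fin 2} {t : Coord A i ψ}
    (ht : t ∈ V.posCoord i ψ) : 0 ≤ V.coordDensity i ψ t := by
  rw [coordDensity, V.genPow_mul_star (V.ofCoord_mem_lowerTriPos ht)]
  exact Finset.prod_nonneg fun k _ => Real.rpow_nonneg (sq_nonneg _) _

/-- The integrand of the gamma integral. -/
def gammaIntegrand (i : I) (ψ : I → Fin 2) (χ : I → ℝ) (Z : Mat A) : ℝ :=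
  Real.exp (-V.tr Z) * V.orbitPow i ψ χ Z

theorem act_zero (T : Mat A) : V.act 0 T = 0 := by
  funext k l
  simp [V.act_apply]

theorem gammaIntegrand_zero {i : I} {χ : I → ℝ} (hχ : χ ∈ multipliers i 0) :
    V.gammaIntegrand i 0 χ 0 = 1 := by
  rw [gammaIntegrand, ← V.act_zero V.one, V.orbitPow_act hχ V.one_mem_lowerTriPos]
  simp [V.act_zero, V.scalar_one, Ops.tr]

variable [∀ i j, FiniteDimensional ℝ (A i j)] [∀ i j, MeasurableSpace (A i j)]
  [∀ i j, BorelSpace (A i j)]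

theorem aemeasurable_coordDensity (i : I) (ψ : I → Fin 2) :
    AEMeasurable (fun t => ENNReal.ofReal (V.coordDensity i ψ t))
      ((volume : Measure (Coord A i ψ)).restrict (V.posCoord i ψ)) := by
  refine AEMeasurable.ennreal_ofReal ⟨fun t => ∏ k with i ≤ k,
    (V.scalar k (V.ofCoord i ψ t k k) ^ 2) ^ dotChi A i ψ k, ?_, ?_⟩
  · refine Finset.measurable_prod _ fun k _ => Measurable.pow_const (Measurable.pow_const ?_ _) _
    exact ((V.continuous_scalar k).comp ((continuous_apply k).comp
      ((continuous_apply k).comp (V.continuous_ofCoord i ψ)))).measurable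
  · refine (ae_restrict_iff' (V.measurableSet_posCoord i ψ)).2
      (Filter.Eventually.of_forall fun t ht => ?_)
    exact V.genPow_mul_star (V.ofCoord_mem_lowerTriPos ht) _ _

/-- The measure `ν_ψ` in coordinates. -/
def coordMeasure (i : I) (ψ : I → Fin 2) : Measure (Coord A i ψ) :=
  ((volume : Measure (Coord A i ψ)).restrict (V.posCoord i ψ)).withDensity fun t =>
    ENNReal.ofReal (V.coordDensity i ψ t)

theorem nu_of_ne_zero (i : I) {ψ : I → Fin 2} (h : ψ ≠ 0) :
    V.nu i ψ = (V.coordMeasure i ψ).map fun t => V.act ψ (V.ofCoord i ψ t) :=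
  if_neg h

theorem ae_mem_posCoord (i : I) (ψ : I → Fin 2) :
    ∀ᵐ t ∂(V.coordMeasure i ψ), t ∈ V.posCoord i ψ :=
  (withDensity_absolutelyContinuous _ _).ae_le (ae_restrict_mem (V.measurableSet_posCoord i ψ))

theorem nu_restrict_orbit (i : I) {ψ : I → Fin 2} (h : ψ ≠ 0) :
    (V.nu i ψ).restrict (V.orbit ψ) = V.nu i ψ := by
  refine Measure.restrict_eq_self_of_ae_mem ?_
  rw [V.nu_of_ne_zero i h]
  exact ae_mem_map_of_injOn (V.measurable_act_ofCoord i ψ) (V.measurableSet_posCoord i ψ)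
    (V.injOn_act_ofCoord i ψ) (V.ae_mem_posCoord i ψ)
    fun t ht => ⟨_, V.ofCoord_mem_lowerTriPos ht, rfl⟩

theorem integrable_coordMeasure_iff (i : I) (ψ : I → Fin 2) (g : Coord A i ψ → ℝ) :
    Integrable g (V.coordMeasure i ψ) ↔
      Integrable ((V.posCoord i ψ).indicator fun t => V.coordDensity i ψ t * g t) := by
  rw [coordMeasure, integrable_withDensity_iff_integrable_smul₀' (V.aemeasurable_coordDensity i ψ)
    (by simp), integrable_indicator_iff (V.measurableSet_posCoord i ψ)]
  refine integrableOn_congr_fun (fun t ht => ?_) (V.measurableSet_posCoord i ψ)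
  simp [ENNReal.toReal_ofReal (V.coordDensity_nonneg ht)]

theorem integral_coordMeasure (i : I) (ψ : I → Fin 2) (g : Coord A i ψ → ℝ) :
    ∫ t, g t ∂(V.coordMeasure i ψ) =
      ∫ t, (V.posCoord i ψ).indicator (fun t => V.coordDensity i ψ t * g t) t := by
  rw [coordMeasure, integral_withDensity_eq_integral_toReal_smul₀
    (V.aemeasurable_coordDensity i ψ) (by simp), integral_indicator (V.measurableSet_posCoord i ψ)]
  refine setIntegral_congr_fun (V.measurableSet_posCoord i ψ) fun t ht => ?_
  simp [ENNReal.toReal_ofReal (V.coordDensity_nonneg ht)]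

theorem integrableOn_gammaIntegrand_iff {i : I} {ψ : I → Fin 2} (h : ψ ≠ 0)
    (hψ : ∀ j, ¬ i ≤ j → ψ j = 0) {χ : I → ℝ} (hχ : χ ∈ multipliers i ψ) :
    IntegrableOn (V.gammaIntegrand i ψ χ) (V.orbit ψ) (V.nu i ψ) ↔
      ∀ j, ψ j = 1 → -1 < diagExponent A ψ χ j := by
  rw [IntegrableOn, V.nu_restrict_orbit i h, V.nu_of_ne_zero i h,
    integrable_map_iff_of_injOn (V.measurable_act_ofCoord i ψ) (V.measurableSet_posCoord i ψ)
      (V.injOn_act_ofCoord i ψ) (V.ae_mem_posCoord i ψ), V.integrable_coordMeasure_iff,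
    ← V.integrable_prod_entryFactor_iff hψ]
  exact integrable_congr (Filter.Eventually.of_forall (V.indicator_integrand_eq_prod hψ hχ))

theorem setIntegral_gammaIntegrand {i : I} {ψ : I → Fin 2} (h : ψ ≠ 0)
    (hψ : ∀ j, ¬ i ≤ j → ψ j = 0) {χ : I → ℝ} (hχ : χ ∈ multipliers i ψ)
    (hq : ∀ j, ψ j = 1 → -1 < diagExponent A ψ χ j) :
    ∫ Z in V.orbit ψ, V.gammaIntegrand i ψ χ Z ∂(V.nu i ψ) =
      (2 : ℝ) ^ (-(absPsi i ψ : ℝ)) * Real.pi ^ ((absN A i ψ : ℝ) / 2) *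
        ∏ j with ψ j = 1, Real.Gamma ((diagExponent A ψ χ j + 1) / 2) := by
  rw [V.nu_restrict_orbit i h, V.nu_of_ne_zero i h,
    integral_map_of_injOn (V.measurable_act_ofCoord i ψ) (V.measurableSet_posCoord i ψ)
      (V.injOn_act_ofCoord i ψ) (V.ae_mem_posCoord i ψ), V.integral_coordMeasure,
    ← V.integral_prod_entryFactor hψ hq]
  exact integral_congr_ae (Filter.Eventually.of_forall (V.indicator_integrand_eq_prod hψ hχ))

theorem nu_zero_restrict_orbit (i : I) :
    (V.nu i 0).restrict (V.orbit 0) = Measure.dirac 0 := by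
  have h0 : (0 : Mat A) ∈ V.orbit 0 := ⟨_, V.one_mem_lowerTriPos, (V.act_zero _).symm⟩
  rw [nu, if_pos rfl]
  exact Measure.restrict_eq_self_of_ae_mem (by rw [ae_dirac_eq]; exact h0)

end Algebra

theorem neg_one_lt_diagExponent_iff {I : Type*} [Fintype I] [PartialOrder I] (A : I → I → Type*)
    [∀ i j, NormedAddCommGroup (A i j)] [∀ i j, InnerProductSpace ℝ (A i j)]
    (ψ : I → Fin 2) (χ : I → ℝ) (j : I) :
    -1 < Algebra.diagExponent A ψ χ j ↔ (nPsi A ψ j : ℝ) / 2 < χ j := by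
  rw [Algebra.diagExponent]
  constructor <;> intro h <;> linarith

end Vinberg

end

theorem theorem3p2 {I : Type*} [Fintype I] [PartialOrder I] {A : I → I → Type*}
    [∀ i j, NormedAddCommGroup (A i j)] [∀ i j, InnerProductSpace ℝ (A i j)]
    [∀ i j, FiniteDimensional ℝ (A i j)] [∀ i j, MeasurableSpace (A i j)]
    [∀ i j, BorelSpace (A i j)] (V : Vinberg.Algebra I A)
    (i : I) (ψ : I → Fin 2) (hψ : ∀ j, ¬ i ≤ j → ψ j = 0)
    (χ : I → ℝ) (hχ : χ ∈ Vinberg.multipliers i ψ) :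
    (MeasureTheory.IntegrableOn (fun Z => Real.exp (-V.tr Z) * V.orbitPow i ψ χ Z)
        (V.orbit ψ) (V.nu i ψ) ↔
      ∀ j, ψ j = 1 → (Vinberg.nPsi A ψ j : ℝ) / 2 < χ j) ∧
    ((∀ j, ψ j = 1 → (Vinberg.nPsi A ψ j : ℝ) / 2 < χ j) →
      ∫ Z in V.orbit ψ, Real.exp (-V.tr Z) * V.orbitPow i ψ χ Z ∂(V.nu i ψ) =
        (2 : ℝ) ^ (-(Vinberg.absPsi i ψ : ℝ)) *
          Real.pi ^ ((Vinberg.absN A i ψ : ℝ) / 2) *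
          ∏ j with ψ j = 1, Real.Gamma (χ j - (Vinberg.nPsi A ψ j : ℝ) / 2)) := by
  change (MeasureTheory.IntegrableOn (V.gammaIntegrand i ψ χ) _ _ ↔ _) ∧
    (_ → ∫ Z in V.orbit ψ, V.gammaIntegrand i ψ χ Z ∂(V.nu i ψ) = _)
  by_cases h : ψ = 0
  · subst h
    rw [MeasureTheory.IntegrableOn, V.nu_zero_restrict_orbit]
    refine ⟨iff_of_true (MeasureTheory.integrable_dirac (by simp)) (by simp), fun _ => ?_⟩
    rw [MeasureTheory.integral_dirac, V.gammaIntegrand_zero hχ]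
    simp [Vinberg.absPsi, Vinberg.absN, Vinberg.nPsi]
  · simp only [← Vinberg.neg_one_lt_diagExponent_iff A ψ χ]
    refine ⟨V.integrableOn_gammaIntegrand_iff h hψ hχ, fun hq => ?_⟩
    rw [V.setIntegral_gammaIntegrand h hψ hχ hq]
    congr! 3 with j
    rw [Vinberg.Algebra.diagExponent]
    ring
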